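/- For a group $P$ and an element $g\in P$, let $k_P(g)$ be the minimum of the orders $|Q|$ over the finite quotients $Q$ of $P$ in which the image of $g$ is nontrivial ($k_P(g)=\infty$ if there is none). For a finite generating set $S$ of $P$, let $\|g\|_S$ be the word length of $g$ with respect to $S$, and let $F_P^S(n)$ be the maximum of $k_P(g)$ over all $g\in P\setminus\{1\}$ with $\|g\|_S\le n$ (and $0$ if there are no such $g$). Let the Hirsch number $h(P)$ be the number of infinite cyclic factors in a finite subnormal series of $P$ whose factors are cyclic or finite (this number does not depend on the series). Theorem. Let $P$ be a finitely generated nilpotent group. Then for every finite generating set $S$ of $P$ we have $F_P^S(n)\preceq (\log n)^{h(P)}$; that is, there is a positive integer $C$ such that $$F_P^S(n)\le C\,\bigl(\log (Cn)\bigr)^{h(P)}\qquad\text{for all integers } n\ge 1 .$$ -/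

import Mathlib

open scoped ENNReal

noncomputable section

namespace ResidualFiniteness

/-- The word length of `g` with respect to `S`: the least length of a word in the letters
`S ∪ S⁻¹` that represents `g` (and `⊤` if there is no such word). -/
def wordLength {G : Type*} [Group G] (S : Set G) (g : G) : ℕ∞ :=
  ⨅ (l : List G) (_ : (∀ x ∈ l, x ∈ S ∨ x⁻¹ ∈ S) ∧ l.prod = g), (l.length : ℕ∞)

/-- `k_G(g)`: the least order of a finite quotient `G ⧸ N` in which the image of `g` is nontrivial
(and `⊤` if there is no such quotient). -/
def minQuotient {G : Type*} [Group G] (g : G) : ℕ∞ :=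
  ⨅ (N : Subgroup G) (_ : N.Normal ∧ Finite (G ⧸ N) ∧ g ∉ N), (Nat.card (G ⧸ N) : ℕ∞)

/-- `F_G^S(n)`: the largest value of `k_G(g)` over the nontrivial `g` of word length at most `n`.
It is `⊤` as soon as one of these elements survives in no finite quotient. -/
def growth {G : Type*} [Group G] (S : Set G) (n : ℕ) : ℕ∞ :=
  ⨆ (g : G) (_ : g ≠ 1 ∧ wordLength S g ≤ n), minQuotient g

/-- The relation `f₁ ≼ f₂`: there is a constant `C` with `f₁ n ≤ C * f₂ (C * n)` for all positive
integers `n`. -/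
def AsympLE (f₁ f₂ : ℕ → ℝ≥0∞) : Prop :=
  ∃ C : ℕ, 0 < C ∧ ∀ n : ℕ, 0 < n → f₁ n ≤ (C : ℝ≥0∞) * f₂ (C * n)

/-- A finite subnormal series `1 = H₀ ⊴ H₁ ⊴ ⋯ ⊴ H_m = G` all of whose factors
`H_{i+1} ⧸ H_i` are cyclic or finite. Only the terms with index at most `m` matter. -/
structure CyclicOrFiniteSeries (G : Type*) [Group G] where
  /-- The number `m` of factors. -/
  length : ℕ
  /-- The terms of the series. -/
  term : ℕ → Subgroup G
  term_zero : term 0 = ⊥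
  term_length : term length = ⊤
  le_succ : ∀ i < length, term i ≤ term (i + 1)
  normal : ∀ i < length, ((term i).subgroupOf (term (i + 1))).Normal
  cyclic_or_finite : ∀ i, ∀ hi : i < length,
    (haveI := normal i hi; IsCyclic (term (i + 1) ⧸ (term i).subgroupOf (term (i + 1)))) ∨
      Finite (term (i + 1) ⧸ (term i).subgroupOf (term (i + 1)))

/-- The number of infinite factors (which are then infinite cyclic) of a series with cyclic or
finite factors. -/
def CyclicOrFiniteSeries.infiniteFactors {G : Type*} [Group G] (s : CyclicOrFiniteSeries G) : ℕ :=
  Set.ncard {i : ℕ | i < s.length ∧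
    Infinite (s.term (i + 1) ⧸ (s.term i).subgroupOf (s.term (i + 1)))}

/-- The Hirsch number of `G`: the number of infinite cyclic factors in a series with cyclic or
finite factors. All such series of `G` have the same number of infinite factors, so that taking
the least one is no restriction. -/
def hirschNumber (G : Type*) [Group G] : ℕ :=
  sInf (Set.range (CyclicOrFiniteSeries.infiniteFactors (G := G)))

end ResidualFiniteness

end

/-
A subgroup `L` of finite index in `P` carries a polynomial function `f : L → ℤ` that takes the value
`f 1` only at `1`. It is built along a series of `P` with cyclic or finite factors: on a split
extension of `ℤ` with nilpotent total group, a polynomial function on the kernel extends to a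
polynomial function on the whole group.

Polynomial functions have polynomial growth in the word length, so for `g ∈ L`, `g ≠ 1` of length at
most `n` some prime `p = O(log n)` above the degree of `f` does not divide `f g - f 1`. Modulo such
a `p`, Newton's formula shows `f` to be invariant under translation by `p`-th powers, whence `g` is
not a product of `p`-th powers in `L`. With `m` an exponent such that `x ^ m ∈ L` for all `x`, the
element `g` survives modulo the `m * p`-th powers of `P`, and these have index at most
`C * (m * p) ^ h(P)`: each infinite cyclic factor contributes at most `m * p`, each finite factor at
most its order.
-/

open scoped commutatorElement

namespace ResidualFiniteness

section PolynomialFunctions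

variable {G H A : Type*} [Group G] [Group H]

/-- The difference of `f` in the direction `y`, for translation by `y` on the left. -/
def leftDiff [Sub A] (y : G) (f : G → A) : G → A := fun z => f (y * z) - f z

section AddCommGroup

variable [AddCommGroup A]

@[simp]
theorem leftDiff_zero (y : G) : leftDiff y (0 : G → A) = 0 := by
  ext; simp [leftDiff]

@[simp]
theorem leftDiff_one (f : G → A) : leftDiff 1 f = 0 := by
  ext; simp [leftDiff]

theorem leftDiff_add (y : G) (f g : G → A) :
    leftDiff y (f + g) = leftDiff y f + leftDiff y g := by
  ext; simp only [leftDiff, Pi.add_apply]; abel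

/-- Polynomial functions of degree less than `d` on a group: all `d`-fold left differences
vanish. -/
def HasDegreeLT : ℕ → (G → A) → Prop
  | 0, f => f = 0
  | d + 1, f => ∀ y, HasDegreeLT d (leftDiff y f)

namespace HasDegreeLT

variable {d e : ℕ} {f g : G → A}

protected theorem zero (d : ℕ) : HasDegreeLT d (0 : G → A) := by
  induction d with
  | zero => rfl
  | succ d ih => exact fun y => (leftDiff_zero (A := A) y).symm ▸ ih

protected theorem succ (hf : HasDegreeLT d f) : HasDegreeLT (d + 1) f := by
  induction d generalizing f with
  | zero => exact fun y => (hf : f = 0) ▸ leftDiff_zero y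
  | succ d ih => exact fun y => ih (hf y)

theorem mono (hf : HasDegreeLT d f) (hde : d ≤ e) : HasDegreeLT e f := by
  induction hde with
  | refl => exact hf
  | step _ ih => exact ih.succ

protected theorem const (a : A) : HasDegreeLT 1 (fun _ : G => a) :=
  fun _ => funext fun _ => sub_self a

protected theorem add (hf : HasDegreeLT d f) (hg : HasDegreeLT d g) : HasDegreeLT d (f + g) := by
  induction d generalizing f g with
  | zero => exact (congrArg₂ (· + ·) hf hg).trans (add_zero 0)
  | succ d ih => exact fun y => leftDiff_add y f g ▸ ih (hf y) (hg y)

theorem sub_const (hf : HasDegreeLT d f) (a : A) :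
    HasDegreeLT (d + 1) (fun z => f z - a) := by
  have hsum := hf.succ.add ((HasDegreeLT.const (-a)).mono (Nat.le_add_left 1 d))
  exact (funext fun z => sub_eq_add_neg (f z) a) ▸ hsum

theorem comp_hom (hf : HasDegreeLT d f) (φ : H →* G) : HasDegreeLT d (f ∘ φ) := by
  induction d generalizing f with
  | zero => exact (hf : f = 0) ▸ rfl
  | succ d ih =>
    intro y
    have hdiff : leftDiff y (f ∘ φ) = leftDiff (φ y) f ∘ φ := by
      ext; simp [leftDiff]
    exact hdiff ▸ ih (hf (φ y))

end HasDegreeLT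

end AddCommGroup

theorem leftDiff_mul [Ring A] (y : G) (f g : G → A) :
    leftDiff y (f * g) = leftDiff y f * leftDiff y g + (leftDiff y f * g + f * leftDiff y g) := by
  ext; simp only [leftDiff, Pi.add_apply, Pi.mul_apply]; noncomm_ring

theorem HasDegreeLT.mul [Ring A] {d e : ℕ} {f g : G → A} (hf : HasDegreeLT d f)
    (hg : HasDegreeLT e g) : HasDegreeLT (d + e) (f * g) := by
  induction d generalizing e f g with
  | zero => exact (hf : f = 0) ▸ (zero_mul g).symm ▸ .zero _
  | succ d ihd =>
    induction e generalizing g with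
    | zero => exact (hg : g = 0) ▸ (mul_zero f).symm ▸ .zero _
    | succ e ihe =>
      rw [Nat.add_right_comm]
      intro y
      rw [leftDiff_mul]
      exact ((ihd (hf y) (hg y)).mono (by omega)).add
        (((ihd (hf y) hg).mono (by omega)).add ((ihe (hg y)).mono (by omega)))

theorem HasDegreeLT.exists_norm_prod_le [SeminormedAddCommGroup A] {d : ℕ} {f : G → A}
    (hf : HasDegreeLT d f) {T : Set G} (hT : T.Finite) :
    ∃ C : ℝ, 0 ≤ C ∧ ∀ l : List G, (∀ x ∈ l, x ∈ T) → ‖f l.prod‖ ≤ C * (l.length + 1) ^ d := by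
  induction d generalizing f with
  | zero => exact ⟨0, le_rfl, fun l _ => by simp [show f = 0 from hf]⟩
  | succ d ih =>
    choose B _ hB using fun y => ih (hf y)
    obtain ⟨M, hM⟩ := (hT.image B).bddAbove
    refine ⟨‖f 1‖ + |M|, by positivity, fun l hl => ?_⟩
    induction l with
    | nil => simp
    | cons y l ihl =>
      have hy : B y ≤ |M| := (hM ⟨y, hl y (by simp), rfl⟩).trans (le_abs_self M)
      have hdiff : ‖f (y * l.prod) - f l.prod‖ ≤ B y * (l.length + 1) ^ d :=
        hB y l fun x hx => hl x (by simp [hx])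
      have hlen : ((l.length : ℝ) + 1) ^ d ≤ (l.length + 1 + 1) ^ d := by gcongr; linarith
      calc ‖f (y :: l).prod‖ ≤ ‖f (y * l.prod) - f l.prod‖ + ‖f l.prod‖ := by
            simpa using norm_le_norm_sub_add (f (y * l.prod)) (f l.prod)
        _ ≤ (‖f 1‖ + |M|) * (l.length + 1) ^ d
              + (‖f 1‖ + |M|) * (l.length + 1) ^ (d + 1) := by
            refine add_le_add (hdiff.trans ?_) (ihl fun x hx => hl x (by simp [hx]))
            gcongr
            linarith [norm_nonneg (f 1)]
        _ = (‖f 1‖ + |M|) * ((l.length + 1) ^ d * (l.length + 1 + 1)) := by ring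
        _ ≤ (‖f 1‖ + |M|) * ((l.length + 1 + 1) ^ d * (l.length + 1 + 1)) := by gcongr
        _ = (‖f 1‖ + |M|) * ((y :: l).length + 1) ^ (d + 1) := by
            rw [List.length_cons]; push_cast; ring

theorem HasDegreeLT.iterate_fwdDiff_pow_mul_eq_zero [AddCommGroup A] {d k : ℕ} {f : G → A}
    (hf : HasDegreeLT d f) (hdk : d ≤ k) (x y : G) :
    (fwdDiff 1)^[k] (fun j : ℕ => f (x ^ j * y)) = 0 := by
  induction k generalizing d f with
  | zero =>
    obtain rfl : d = 0 := Nat.le_zero.1 hdk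
    exact (hf : f = 0) ▸ rfl
  | succ k ih =>
    have hdiff : fwdDiff 1 (fun j : ℕ => f (x ^ j * y)) = fun j => leftDiff x f (x ^ j * y) := by
      ext j; simp [fwdDiff, leftDiff, pow_succ', mul_assoc]
    rw [Function.iterate_succ_apply, hdiff]
    exact ih ((hf.mono hdk : HasDegreeLT (k + 1) f) x) le_rfl

theorem HasDegreeLT.natCast_dvd_pow_mul_sub [Ring A] {d p : ℕ} {f : G → A}
    (hf : HasDegreeLT d f) (hp : p.Prime) (hdp : d ≤ p) (x y : G) :
    (p : A) ∣ f (x ^ p * y) - f y := by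
  have newton := shift_eq_sum_fwdDiff_iter 1 (fun j : ℕ => f (x ^ j * y)) p 0
  simp only [Finset.sum_range_succ', zero_add, smul_eq_mul, mul_one, Nat.choose_zero_right,
    one_smul, Function.iterate_zero, id, pow_zero, one_mul] at newton
  rw [newton, add_sub_cancel_right]
  refine Finset.dvd_sum fun k hk => ?_
  rcases (Nat.succ_le_of_lt (Finset.mem_range.1 hk)).lt_or_eq with hkp | hkp
  · rw [nsmul_eq_mul]
    exact (Nat.cast_dvd_cast (hp.dvd_choose_self k.succ_ne_zero hkp)).mul_right _
  · have hvanish := hf.iterate_fwdDiff_pow_mul_eq_zero (hdp.trans hkp.ge) x y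
    simp [hvanish]

end PolynomialFunctions

section WeightedFunctions

variable {G Q A : Type*} [Group G] [Group Q] [AddCommGroup A]

/-- Functions of weight less than `k` for a descending chain of subgroups `F`: every chain of
successive left differences in the directions `n₁ ∈ F i₁, …, nᵣ ∈ F iᵣ` with `∑ (iⱼ + 1) ≥ k`
vanishes. Thus elements of `F i` count with weight `i + 1`. -/
inductive HasWeightLT (F : ℕ → Subgroup G) : ℕ → (G → A) → Prop
  | zero (k : ℕ) : HasWeightLT F k 0
  | succ {k : ℕ} {f : G → A} (hf : ∀ i, ∀ n ∈ F i, HasWeightLT F (k - i) (leftDiff n f)) :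
      HasWeightLT F (k + 1) f

namespace HasWeightLT

variable {F : ℕ → Subgroup G} {k l : ℕ} {f g : G → A}

theorem eq_zero (hf : HasWeightLT F 0 f) : f = 0 := by
  cases hf; rfl

theorem leftDiff_of_mem (hf : HasWeightLT F (k + 1) f) {i : ℕ} {n : G} (hn : n ∈ F i) :
    HasWeightLT F (k - i) (leftDiff n f) := by
  cases hf with
  | zero => exact (leftDiff_zero (A := A) n).symm ▸ .zero _
  | succ hf => exact hf i n hn

theorem mono (hf : HasWeightLT F k f) (hkl : k ≤ l) : HasWeightLT F l f := by
  induction hf generalizing l with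
  | zero => exact .zero l
  | succ _ ih =>
    obtain ⟨l, rfl⟩ := Nat.exists_eq_succ_of_ne_zero (by omega : l ≠ 0)
    exact .succ fun i n hn => ih i n hn (by omega)

theorem add (hf : HasWeightLT F k f) (hg : HasWeightLT F k g) : HasWeightLT F k (f + g) := by
  induction hf generalizing g with
  | zero => exact (zero_add g).symm ▸ hg
  | succ _ ih =>
    exact .succ fun i n hn => leftDiff_add n _ g ▸ ih i n hn (hg.leftDiff_of_mem hn)

theorem comp_mul_left (hf : HasWeightLT F k f) {i : ℕ} {n : G} (hn : n ∈ F i) :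
    HasWeightLT F k fun z => f (n * z) := by
  cases k with
  | zero => exact hf.eq_zero ▸ .zero 0
  | succ k =>
    have hsum : (fun z => f (n * z)) = leftDiff n f + f := by
      ext; simp [leftDiff]
    exact hsum ▸ ((hf.leftDiff_of_mem hn).mono (by omega)).add hf

end HasWeightLT

theorem HasDegreeLT.hasWeightLT {F : ℕ → Subgroup G} (hF : Antitone F) {c : ℕ} (hc : F c = ⊥)
    {d : ℕ} {f : G → A} (hf : HasDegreeLT d f) : HasWeightLT F ((c + 1) * d) f := by
  induction d generalizing f with
  | zero => exact (hf : f = 0) ▸ .zero _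
  | succ d ih =>
    refine .succ (k := (c + 1) * d + c) fun i n hn => ?_
    rcases le_total i c with hic | hci
    · exact (ih (hf n)).mono (by omega)
    · obtain rfl : n = 1 := Subgroup.mem_bot.1 (hc ▸ hF hci hn)
      exact leftDiff_one f ▸ .zero _

theorem leftDiff_comp_sub {σ a : G → G} {n : G} (hσ : ∀ z, σ (n * z) = a n * σ z) (f : G → A) :
    leftDiff n (f ∘ σ - f) = (leftDiff (a n) f ∘ σ - leftDiff (a n) f) +
      fun z => leftDiff (a n * n⁻¹) f (n * z) := by
  ext z
  simp only [leftDiff, Pi.sub_apply, Pi.add_apply, Function.comp_apply, hσ, mul_assoc,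
    inv_mul_cancel_left]
  abel

/-
`σ` twists translation by `n` into translation by `a n`, which has the same image in the graded
group of `F`; this gains one unit of weight.
-/
theorem HasWeightLT.comp_sub {F : ℕ → Subgroup G} (hF : Antitone F) (hF0 : F 0 = ⊤)
    {σ a : G → G} (hσ : ∀ n z, σ (n * z) = a n * σ z)
    (ha : ∀ i, ∀ n ∈ F i, a n * n⁻¹ ∈ F (i + 1)) {k : ℕ} {f : G → A}
    (hf : HasWeightLT F k f) : HasWeightLT F (k - 1) (f ∘ σ - f) := by
  induction hf with
  | zero => exact (sub_self (0 : G → A)).symm ▸ .zero _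
  | @succ k f hf ih =>
    rw [Nat.add_sub_cancel]
    cases k with
    | zero =>
      have hdiff (y : G) : leftDiff y f = 0 := (hf 0 y (hF0 ▸ Subgroup.mem_top y)).eq_zero
      have hzero : f ∘ σ - f = 0 := funext fun z => by
        simpa [leftDiff] using congrFun (hdiff (σ z * z⁻¹)) z
      exact hzero ▸ .zero 0
    | succ k =>
      refine .succ fun i n hn => ?_
      rw [leftDiff_comp_sub (hσ n)]
      have han : a n ∈ F i := by
        simpa using mul_mem (hF i.le_succ (ha i n hn)) hn
      refine ((ih i (a n) han).mono (by omega)).add (comp_mul_left ?_ hn)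
      exact (hf (i + 1) _ (ha i n hn)).mono (by omega)

end WeightedFunctions

section SplitExtensions

variable {L Q A : Type*} [Group L] [Group Q] [AddCommGroup A]

/-- The traces on `N` of the terms of the lower central series of the whole group: a filtration of
`N` on whose successive quotients the whole group acts trivially by conjugation. -/
def lowerCentralTrace (N : Subgroup L) (i : ℕ) : Subgroup N :=
  ((⊤ : Subgroup L).lowerCentralSeries i).subgroupOf N

theorem lowerCentralTrace_antitone (N : Subgroup L) : Antitone (lowerCentralTrace N) :=
  fun _ _ hij => Subgroup.comap_mono (Subgroup.lowerCentralSeries_antitone _ hij)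

theorem conjNormal_mul_inv_mem_lowerCentralTrace {N : Subgroup L} [N.Normal] (y : L) {i : ℕ}
    {n : N} (hn : n ∈ lowerCentralTrace N i) :
    MulAut.conjNormal y n * n⁻¹ ∈ lowerCentralTrace N (i + 1) := by
  have hcomm := Subgroup.commutator_mem_commutator (Subgroup.mem_top y)
    (Subgroup.mem_subgroupOf.1 hn)
  rw [Subgroup.commutator_comm, commutatorElement_def] at hcomm
  simpa [lowerCentralTrace, Subgroup.mem_subgroupOf] using hcomm

variable {φ : L →* Q} {s : Q →* L}

/-- The component in the kernel `N` of `φ` for the decomposition `L = N ⋊ s(Q)` given by a section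
`s` of `φ`. -/
def kerComponent (hs : φ.comp s = .id Q) (z : L) : φ.ker :=
  ⟨z * (s (φ z))⁻¹, by simp [φ.mem_ker, ← φ.comp_apply s, hs]⟩

theorem kerComponent_mul (hs : φ.comp s = .id Q) (y z : L) :
    kerComponent hs (y * z) = MulAut.conjNormal y (kerComponent hs z) * kerComponent hs y :=
  Subtype.ext <| by simp [kerComponent, mul_assoc]

theorem HasWeightLT.hasDegreeLT_comp_kerComponent (hs : φ.comp s = .id Q) {k : ℕ}
    {f : φ.ker → A} (hf : HasWeightLT (lowerCentralTrace φ.ker) k f) :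
    HasDegreeLT k (f ∘ kerComponent hs) := by
  induction k generalizing f with
  | zero => exact hf.eq_zero ▸ rfl
  | succ k ih =>
    intro y
    have hdiff : leftDiff y (f ∘ kerComponent hs) =
        (f ∘ (fun n => MulAut.conjNormal y n * kerComponent hs y) - f) ∘ kerComponent hs := by
      ext z; simp [leftDiff, kerComponent_mul]
    have htop : lowerCentralTrace φ.ker 0 = ⊤ := by simp [lowerCentralTrace]
    exact hdiff ▸ ih (hf.comp_sub (lowerCentralTrace_antitone _) htop
      (fun n z => by rw [map_mul, mul_assoc])
      fun _ _ => conjNormal_mul_inv_mem_lowerCentralTrace y)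

theorem HasDegreeLT.exists_comp_kerComponent [Group.IsNilpotent L] (hs : φ.comp s = .id Q)
    {d : ℕ} {f : φ.ker → A} (hf : HasDegreeLT d f) : ∃ e, HasDegreeLT e (f ∘ kerComponent hs) := by
  have hbot : lowerCentralTrace φ.ker (Group.nilpotencyClass L) = ⊥ := by
    simp [lowerCentralTrace]
  exact ⟨_, (hf.hasWeightLT (lowerCentralTrace_antitone _) hbot).hasDegreeLT_comp_kerComponent hs⟩

/-- Some integer valued polynomial function on `G` takes its value at `1` nowhere else, so that its
residues modulo primes tell nontrivial elements from `1`. -/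
def HasSeparatingPolynomial (G : Type*) [Group G] : Prop :=
  ∃ (d : ℕ) (f : G → ℤ), HasDegreeLT d f ∧ ∀ g, f g = f 1 → g = 1

namespace HasSeparatingPolynomial

theorem of_subsingleton [Subsingleton L] : HasSeparatingPolynomial L :=
  ⟨0, 0, rfl, fun _ _ => Subsingleton.elim _ _⟩

theorem multiplicative_int : HasSeparatingPolynomial (Multiplicative ℤ) :=
  ⟨2, Multiplicative.toAdd, fun y z => funext fun w => by simp [leftDiff], fun _ hg => hg⟩

theorem of_injective (hQ : HasSeparatingPolynomial Q) {φ : L →* Q} (hφ : Function.Injective φ) :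
    HasSeparatingPolynomial L := by
  obtain ⟨d, f, hf, hsep⟩ := hQ
  refine ⟨d, f ∘ φ, hf.comp_hom φ, fun g hg => hφ ?_⟩
  rw [map_one]
  exact hsep _ (by simpa using hg)

theorem of_split [Group.IsNilpotent L] (hN : HasSeparatingPolynomial φ.ker)
    (hQ : HasSeparatingPolynomial Q) (hs : φ.comp s = .id Q) : HasSeparatingPolynomial L := by
  obtain ⟨d, f, hf, hfsep⟩ := hN
  obtain ⟨e, k, hk, hksep⟩ := hQ
  obtain ⟨d', hf'⟩ := hf.exists_comp_kerComponent hs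
  have hNsub := hf'.sub_const (f 1)
  have hQsub := (hk.comp_hom φ).sub_const (k 1)
  refine ⟨_, _, ((hNsub.mul hNsub).mono (le_max_left _ _)).add
    ((hQsub.mul hQsub).mono (le_max_right _ _)), fun g hg => ?_⟩
  have hone : kerComponent hs 1 = 1 := by ext; simp [kerComponent]
  simp only [Pi.add_apply, Pi.mul_apply, Function.comp_apply, hone, map_one, sub_self, mul_zero,
    add_zero, mul_self_add_mul_self_eq_zero, sub_eq_zero] at hg
  have hker : kerComponent hs g = 1 := hfsep _ hg.1
  simpa [kerComponent, Subtype.ext_iff, hksep _ hg.2] using hker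

end HasSeparatingPolynomial

end SplitExtensions

section PowerSubgroups

variable {G : Type*} [Group G]

/-- The subgroup generated by the `m`-th powers of the elements of `H`. -/
def powSubgroup (H : Subgroup G) (m : ℕ) : Subgroup G :=
  Subgroup.closure ((· ^ m) '' (H : Set G))

theorem powSubgroup_le_iff {H K : Subgroup G} {m : ℕ} :
    powSubgroup H m ≤ K ↔ ∀ x ∈ H, x ^ m ∈ K := by
  simp [powSubgroup, Set.subset_def]

theorem pow_mem_powSubgroup {H : Subgroup G} {x : G} (hx : x ∈ H) (m : ℕ) :
    x ^ m ∈ powSubgroup H m :=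
  powSubgroup_le_iff.1 le_rfl x hx

theorem normalizer_le_normalizer_powSubgroup (H : Subgroup G) (m : ℕ) :
    Subgroup.normalizer (H : Set G) ≤ Subgroup.normalizer (powSubgroup H m : Set G) := by
  refine (Subgroup.le_normalizer_closure_iff).2 ?_
  rintro y hy _ ⟨x, hx, rfl⟩
  have hconj : y * x * y⁻¹ ∈ H := (Subgroup.mem_normalizer_iff.1 hy x).1 hx
  exact conj_pow (a := y) (b := x) ▸ pow_mem_powSubgroup hconj m

instance powSubgroup_normal (H : Subgroup G) [H.Normal] (m : ℕ) : (powSubgroup H m).Normal :=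
  Subgroup.normalizer_eq_top_iff.1 <| top_le_iff.1 <|
    (Subgroup.normalizer_eq_top_iff.2 ‹_›).ge.trans (normalizer_le_normalizer_powSubgroup H m)

theorem HasDegreeLT.natCast_dvd_sub_of_mem_powSubgroup {A : Type*} [Ring A] {d p : ℕ} {f : G → A}
    (hf : HasDegreeLT d f) (hp : p.Prime) (hdp : d ≤ p) {g : G} (hg : g ∈ powSubgroup ⊤ p) :
    (p : A) ∣ f g - f 1 := by
  suffices key : ∀ y, (p : A) ∣ f (g * y) - f y by simpa using key 1
  induction hg using Subgroup.closure_induction with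
  | mem g hg =>
    obtain ⟨x, -, rfl⟩ := hg
    exact hf.natCast_dvd_pow_mul_sub hp hdp x
  | one => simp
  | mul a b _ _ iha ihb => exact fun y => by simpa [mul_assoc] using (iha (b * y)).add (ihb y)
  | inv a _ iha => exact fun y => dvd_sub_comm.1 <| by simpa using iha (a⁻¹ * y)

end PowerSubgroups

section SplitSubgroups

variable {K Q : Type*} [Group K] [Group Q] {φ : K →* Q} {s : Q →* K}

theorem mem_of_mem_sup_range_of_mem_ker (hs : φ.comp s = .id Q) {V : Subgroup K} [V.Normal]
    (hV : V ≤ φ.ker) {g : K} (hg : g ∈ V ⊔ s.range) (hφg : φ g = 1) : g ∈ V := by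
  obtain ⟨v, hv, _, ⟨q, rfl⟩, rfl⟩ := Subgroup.mem_sup_of_normal_left.1 hg
  have hq : φ (s q) = q := DFunLike.congr_fun hs q
  rw [map_mul, hV hv, one_mul, hq] at hφg
  simpa [hφg] using hv

theorem HasSeparatingPolynomial.sup_range [Group.IsNilpotent K] (hs : φ.comp s = .id Q)
    {V : Subgroup K} [V.Normal] (hVφ : V ≤ φ.ker) (hV : HasSeparatingPolynomial V)
    (hQ : HasSeparatingPolynomial Q) : HasSeparatingPolynomial ↥(V ⊔ s.range) := by
  let ψ : ↥(V ⊔ s.range) →* Q := φ.comp (V ⊔ s.range).subtype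
  let t : Q →* ↥(V ⊔ s.range) := s.codRestrict _ fun q => le_sup_right (a := V) ⟨q, rfl⟩
  have ht : ψ.comp t = .id Q := hs
  let ι : ψ.ker →* V := ((V ⊔ s.range).subtype.comp ψ.ker.subtype).codRestrict V
    fun g => mem_of_mem_sup_range_of_mem_ker hs hVφ g.1.2 g.2
  have hι : Function.Injective ι := fun a b hab => Subtype.ext <| Subtype.ext <|
    congrArg (Subtype.val : V → K) hab
  exact (hV.of_injective hι).of_split hQ ht

theorem index_sup_range_ne_zero (hs : φ.comp s = .id Q) {V : Subgroup K}
    (hV : V.relIndex φ.ker ≠ 0) : (V ⊔ s.range).index ≠ 0 := by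
  have hfin : Finite (φ.ker ⧸ V.subgroupOf φ.ker) := Nat.finite_of_card_ne_zero hV
  let q : φ.ker ⧸ V.subgroupOf φ.ker → K ⧸ (V ⊔ s.range) :=
    Quotient.map' Subtype.val fun a b hab => by
      rw [QuotientGroup.leftRel_apply] at hab ⊢
      exact le_sup_left (a := V) hab
  have hq : Function.Surjective q := by
    intro z
    obtain ⟨g, rfl⟩ := QuotientGroup.mk_surjective z
    refine ⟨QuotientGroup.mk (kerComponent hs g), QuotientGroup.eq.2 ?_⟩
    simpa [kerComponent] using Subgroup.mem_sup_right (S := V) (s.mem_range.2 ⟨φ g, rfl⟩)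
  have := Finite.of_surjective q hq
  exact Subgroup.index_ne_zero_of_finite

theorem exists_section_of_isCyclic_quotient (N : Subgroup K) [N.Normal] [IsCyclic (K ⧸ N)]
    [Infinite (K ⧸ N)] : ∃ (φ : K →* Multiplicative ℤ) (s : Multiplicative ℤ →* K),
      φ.ker = N ∧ φ.comp s = .id _ := by
  let φ : K →* Multiplicative ℤ :=
    (intCyclicMulEquiv (G := K ⧸ N)).symm.toMonoidHom.comp (QuotientGroup.mk' N)
  have hφ : Function.Surjective φ :=
    intCyclicMulEquiv.symm.surjective.comp (QuotientGroup.mk'_surjective N)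
  obtain ⟨x, hx⟩ := hφ (.ofAdd 1)
  refine ⟨φ, zpowersHom K x, ?_, ?_⟩
  · ext g; simp [φ]
  · ext
    simp [hx]

end SplitSubgroups

theorem HasSeparatingPolynomial.exists_of_isCyclic_quotient {K : Type*} [Group K]
    [Group.IsNilpotent K] {N V : Subgroup K} [N.Normal] [IsCyclic (K ⧸ N)] [Infinite (K ⧸ N)]
    [V.Normal] (hVN : V ≤ N) (hVindex : V.relIndex N ≠ 0) (hV : HasSeparatingPolynomial V) :
    ∃ L : Subgroup K, L.index ≠ 0 ∧ HasSeparatingPolynomial L := by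
  obtain ⟨φ, s, rfl, hs⟩ := exists_section_of_isCyclic_quotient N
  exact ⟨V ⊔ s.range, index_sup_range_ne_zero hs hVindex, hV.sup_range hs hVN .multiplicative_int⟩

section Series

variable {G : Type*} [Group G]

/-- `H` has a finite subnormal series whose factors are cyclic or finite and of which exactly `h`
are infinite. -/
inductive HasCyclicOrFiniteSeries : Subgroup G → ℕ → Prop
  | bot : HasCyclicOrFiniteSeries ⊥ 0
  | finite {H K : Subgroup G} {h : ℕ} (hH : HasCyclicOrFiniteSeries H h) (hHK : H ≤ K)
      [(H.subgroupOf K).Normal] [Finite (K ⧸ H.subgroupOf K)] : HasCyclicOrFiniteSeries K h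
  | cyclic {H K : Subgroup G} {h : ℕ} (hH : HasCyclicOrFiniteSeries H h) (hHK : H ≤ K)
      [(H.subgroupOf K).Normal] [IsCyclic (K ⧸ H.subgroupOf K)]
      [Infinite (K ⧸ H.subgroupOf K)] : HasCyclicOrFiniteSeries K (h + 1)

theorem relIndex_mul_index_sup {H K V : Subgroup G} (hHK : H ≤ K)
    [(V.subgroupOf K).Normal] :
    V.relIndex H * (V.subgroupOf K ⊔ H.subgroupOf K).index = V.relIndex K := by
  rw [← Subgroup.relIndex_subgroupOf hHK, ← Subgroup.relIndex_sup_left,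
    Subgroup.relIndex_mul_index le_sup_left, Subgroup.relIndex]

theorem index_dvd_of_forall_pow_mem {N W : Subgroup G} [N.Normal] [W.Normal] [IsCyclic (G ⧸ N)]
    (hNW : N ≤ W) {m : ℕ} (hm : ∀ g, g ^ m ∈ W) : W.index ∣ m := by
  have hcyc : IsCyclic (G ⧸ W) := isCyclic_of_surjective
    (QuotientGroup.map N W (.id G) hNW)
    (QuotientGroup.map_surjective_of_surjective N W _ QuotientGroup.mk_surjective _)
  rw [Subgroup.index, ← IsCyclic.exponent_eq_card, Monoid.exponent_dvd_iff_forall_pow_eq_one]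
  intro q
  obtain ⟨g, rfl⟩ := QuotientGroup.mk_surjective q
  exact (QuotientGroup.eq_one_iff _).2 (hm g)

namespace HasCyclicOrFiniteSeries

theorem exists_relIndex_dvd {H : Subgroup G} {h : ℕ} (hH : HasCyclicOrFiniteSeries H h) :
    ∃ C : ℕ, C ≠ 0 ∧ ∀ (m : ℕ) (V : Subgroup G), H ≤ Subgroup.normalizer (V : Set G) →
      (∀ g ∈ H, g ^ m ∈ V) → V.relIndex H ∣ C * m ^ h := by
  induction hH with
  | bot => exact ⟨1, one_ne_zero, fun m V _ _ => by simp⟩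
  | @finite H K h _ hHK _ _ ih =>
    obtain ⟨C, hC, hdvd⟩ := ih
    refine ⟨C * H.relIndex K, mul_ne_zero hC Subgroup.index_ne_zero_of_finite,
      fun m V hV hpow => ?_⟩
    have := Subgroup.normal_subgroupOf_of_le_normalizer hV
    rw [← relIndex_mul_index_sup hHK, mul_right_comm]
    exact mul_dvd_mul (hdvd m V (hHK.trans hV) fun g hg => hpow g (hHK hg))
      (Subgroup.index_dvd_of_le le_sup_right)
  | @cyclic H K h _ hHK _ _ _ ih =>
    obtain ⟨C, hC, hdvd⟩ := ih
    refine ⟨C, hC, fun m V hV hpow => ?_⟩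
    have := Subgroup.normal_subgroupOf_of_le_normalizer hV
    rw [← relIndex_mul_index_sup hHK, pow_succ, ← mul_assoc]
    exact mul_dvd_mul (hdvd m V (hHK.trans hV) fun g hg => hpow g (hHK hg))
      (index_dvd_of_forall_pow_mem le_sup_right fun g => Subgroup.mem_sup_left (hpow g g.2))

end HasCyclicOrFiniteSeries

theorem exists_pow_mem_of_relIndex_ne_zero {L H : Subgroup G} (hL : L.relIndex H ≠ 0) :
    ∃ m : ℕ, m ≠ 0 ∧ ∀ x ∈ H, x ^ m ∈ L :=
  ⟨(L.relIndex H).factorial, Nat.factorial_ne_zero _, fun _ hx =>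
    (Subgroup.pow_mem_of_relIndex_ne_zero_of_dvd hL hx fun _ => Nat.dvd_factorial).1⟩

theorem HasSeparatingPolynomial.of_le {L M : Subgroup G} (hM : HasSeparatingPolynomial M)
    (hLM : L ≤ M) : HasSeparatingPolynomial L :=
  hM.of_injective (Subgroup.inclusion_injective hLM)

theorem HasCyclicOrFiniteSeries.exists_le_normalizer_le_of_relIndex_ne_zero {H L : Subgroup G}
    {h : ℕ} (hH : HasCyclicOrFiniteSeries H h) (hL : L.relIndex H ≠ 0) :
    ∃ V ≤ L, V.relIndex H ≠ 0 ∧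
      Subgroup.normalizer (H : Set G) ≤ Subgroup.normalizer (V : Set G) := by
  obtain ⟨m, hm, hpow⟩ := exists_pow_mem_of_relIndex_ne_zero hL
  obtain ⟨C, hC, hdvd⟩ := hH.exists_relIndex_dvd
  have hnormalizer := normalizer_le_normalizer_powSubgroup H m
  have hdvd_index : (powSubgroup H m).relIndex H ∣ C * m ^ h :=
    hdvd m _ (Subgroup.le_normalizer.trans hnormalizer) fun g hg => pow_mem_powSubgroup hg m
  exact ⟨powSubgroup H m, powSubgroup_le_iff.2 hpow,
    ne_zero_of_dvd_ne_zero (mul_ne_zero hC (pow_ne_zero h hm)) hdvd_index, hnormalizer⟩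

theorem HasCyclicOrFiniteSeries.exists_hasSeparatingPolynomial [Group.IsNilpotent G]
    {H : Subgroup G} {h : ℕ} (hH : HasCyclicOrFiniteSeries H h) :
    ∃ L ≤ H, L.relIndex H ≠ 0 ∧ HasSeparatingPolynomial L := by
  induction hH with
  | bot => exact ⟨⊥, le_rfl, by simp, .of_subsingleton⟩
  | @finite H K _ _ hHK _ _ ih =>
    obtain ⟨L, hLH, hindex, hL⟩ := ih
    refine ⟨L, hLH.trans hHK, ?_, hL⟩
    rw [← Subgroup.relIndex_mul_relIndex L H K hLH hHK]
    exact mul_ne_zero hindex Subgroup.index_ne_zero_of_finite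
  | @cyclic H K _ hH hHK _ _ _ ih =>
    obtain ⟨L, hLH, hindex, hL⟩ := ih
    obtain ⟨V, hVL, hVindex, hnormalizer⟩ :=
      hH.exists_le_normalizer_le_of_relIndex_ne_zero hindex
    have := Subgroup.normal_subgroupOf_of_le_normalizer <|
      (Subgroup.le_normalizer_of_normal_subgroupOf hHK).trans hnormalizer
    have hV : HasSeparatingPolynomial (V.subgroupOf K) :=
      (hL.of_le hVL).of_injective
        (φ := (Subgroup.subgroupOfEquivOfLe (hVL.trans (hLH.trans hHK))).toMonoidHom)
        (MulEquiv.injective _)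
    obtain ⟨M, hMindex, hM⟩ := hV.exists_of_isCyclic_quotient (N := H.subgroupOf K)
      (V := V.subgroupOf K) (Subgroup.comap_mono (hVL.trans hLH))
      (by rwa [Subgroup.relIndex_subgroupOf hHK])
    refine ⟨M.map K.subtype, Subgroup.map_subtype_le M, ?_, ?_⟩
    · rwa [Subgroup.relIndex, Subgroup.subgroupOf,
        Subgroup.comap_map_eq_self_of_injective K.subtype_injective]
    · exact hM.of_injective (φ := (M.equivMapOfInjective _ K.subtype_injective).symm.toMonoidHom)
        (MulEquiv.injective _)

end Series

section ExistenceOfSeries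

variable {G : Type*} [Group G]

theorem CyclicOrFiniteSeries.hasCyclicOrFiniteSeries (s : CyclicOrFiniteSeries G) :
    HasCyclicOrFiniteSeries (⊤ : Subgroup G) s.infiniteFactors := by
  classical
  let IsInf (i : ℕ) : Prop := Infinite (s.term (i + 1) ⧸ (s.term i).subgroupOf (s.term (i + 1)))
  have hterm : ∀ n ≤ s.length, HasCyclicOrFiniteSeries (s.term n) (Nat.count IsInf n) := by
    intro n hn
    induction n with
    | zero => simpa [s.term_zero] using HasCyclicOrFiniteSeries.bot
    | succ n ih =>
      have hnormal := s.normal n hn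
      rw [Nat.count_succ]
      split_ifs with hinf
      · have hinf : Infinite _ := hinf
        have := (s.cyclic_or_finite n hn).resolve_right (not_finite_iff_infinite.2 hinf)
        exact (ih (Nat.le_of_succ_le hn)).cyclic (s.le_succ n hn)
      · have := not_infinite_iff_finite.1 hinf
        exact (ih (Nat.le_of_succ_le hn)).finite (s.le_succ n hn)
  have hcount : s.infiniteFactors = Nat.count IsInf s.length := by
    rw [Nat.count_eq_card_filter_range, ← Set.ncard_coe_finset,
      CyclicOrFiniteSeries.infiniteFactors]
    simp [IsInf]
  exact hcount ▸ s.term_length ▸ hterm s.length le_rfl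

/-- `H` is normal in `K` with cyclic or finite quotient. -/
def IsCyclicOrFiniteFactor (H K : Subgroup G) : Prop :=
  H ≤ K ∧ ∃ _ : (H.subgroupOf K).Normal, IsCyclic (K ⧸ H.subgroupOf K) ∨
    Finite (K ⧸ H.subgroupOf K)

theorem IsCyclicOrFiniteFactor.exists_hasCyclicOrFiniteSeries {H K : Subgroup G} {h : ℕ}
    (hHK : IsCyclicOrFiniteFactor H K) (hH : HasCyclicOrFiniteSeries H h) :
    ∃ h', HasCyclicOrFiniteSeries K h' := by
  obtain ⟨hle, _, hfactor⟩ := hHK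
  rcases finite_or_infinite (K ⧸ H.subgroupOf K) with hfin | hinf
  · exact ⟨h, hH.finite hle⟩
  · have := hfactor.resolve_right (not_finite_iff_infinite.2 hinf)
    exact ⟨h + 1, hH.cyclic hle⟩

theorem HasCyclicOrFiniteSeries.exists_terms {H : Subgroup G} {h : ℕ}
    (hH : HasCyclicOrFiniteSeries H h) :
    ∃ (n : ℕ) (t : ℕ → Subgroup G), t 0 = ⊥ ∧ t n = H ∧
      ∀ i < n, IsCyclicOrFiniteFactor (t i) (t (i + 1)) := by
  have extend {H K : Subgroup G} (hHK : IsCyclicOrFiniteFactor H K)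
      (ih : ∃ (n : ℕ) (t : ℕ → Subgroup G), t 0 = ⊥ ∧ t n = H ∧
        ∀ i < n, IsCyclicOrFiniteFactor (t i) (t (i + 1))) :
      ∃ (n : ℕ) (t : ℕ → Subgroup G), t 0 = ⊥ ∧ t n = K ∧
        ∀ i < n, IsCyclicOrFiniteFactor (t i) (t (i + 1)) := by
    obtain ⟨n, t, h0, hn, ht⟩ := ih
    refine ⟨n + 1, fun i => if i ≤ n then t i else K, by simpa using h0, by simp, fun i hi => ?_⟩
    rcases Nat.lt_succ_iff_lt_or_eq.1 hi with hin | rfl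
    · simpa [hin.le, Nat.succ_le_of_lt hin] using ht i hin
    · simpa [hn] using hHK
  induction hH with
  | bot => exact ⟨0, fun _ => ⊥, rfl, rfl, by simp⟩
  | finite _ hHK ih => exact extend ⟨hHK, ‹_›, .inr ‹_›⟩ ih
  | cyclic _ hHK ih => exact extend ⟨hHK, ‹_›, .inl ‹_›⟩ ih

theorem HasCyclicOrFiniteSeries.nonempty_cyclicOrFiniteSeries {h : ℕ}
    (hG : HasCyclicOrFiniteSeries (⊤ : Subgroup G) h) : Nonempty (CyclicOrFiniteSeries G) := by
  obtain ⟨n, t, h0, hn, ht⟩ := hG.exists_terms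
  exact ⟨{
    length := n
    term := t
    term_zero := h0
    term_length := hn
    le_succ := fun i hi => (ht i hi).1
    normal := fun i hi => (ht i hi).2.fst
    cyclic_or_finite := fun i hi => (ht i hi).2.snd }⟩

theorem hasCyclicOrFiniteSeries_hirschNumber [Nonempty (CyclicOrFiniteSeries G)] :
    HasCyclicOrFiniteSeries (⊤ : Subgroup G) (hirschNumber G) := by
  obtain ⟨s, hs⟩ := Nat.sInf_mem <|
    Set.range_nonempty (CyclicOrFiniteSeries.infiniteFactors (G := G))
  rw [hirschNumber, ← hs]
  exact s.hasCyclicOrFiniteSeries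

theorem isCyclicOrFiniteFactor_zpowers_sup (x : G) (H : Subgroup G) [H.Normal] :
    IsCyclicOrFiniteFactor H (Subgroup.zpowers x ⊔ H) := by
  have hcyc : IsCyclic (Subgroup.zpowers x ⧸ H.subgroupOf (Subgroup.zpowers x)) :=
    isCyclic_of_surjective _ (QuotientGroup.mk'_surjective _)
  exact ⟨le_sup_right, inferInstance, .inl <| isCyclic_of_surjective _
    (QuotientGroup.quotientInfEquivProdNormalQuotient (Subgroup.zpowers x) H).surjective⟩

theorem normal_closure_sup {N M : Subgroup G} (hNM : N ≤ M) (hMN : ⁅M, (⊤ : Subgroup G)⁆ ≤ N)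
    {X : Set G} (hXM : X ⊆ M) : (Subgroup.closure X ⊔ N).Normal := by
  rw [← Subgroup.commutator_top_right_le_iff]
  calc ⁅Subgroup.closure X ⊔ N, (⊤ : Subgroup G)⁆ ≤ ⁅M, ⊤⁆ :=
        Subgroup.commutator_mono (sup_le ((Subgroup.closure_le M).2 hXM) hNM) le_rfl
    _ ≤ N := hMN
    _ ≤ Subgroup.closure X ⊔ N := le_sup_right

theorem HasCyclicOrFiniteSeries.closure_sup {N M : Subgroup G} {h : ℕ}
    (hN : HasCyclicOrFiniteSeries N h) (hNM : N ≤ M) (hMN : ⁅M, (⊤ : Subgroup G)⁆ ≤ N)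
    {X : Set G} (hX : X.Finite) (hXM : X ⊆ M) :
    ∃ h', HasCyclicOrFiniteSeries (Subgroup.closure X ⊔ N) h' := by
  induction X, hX using Set.Finite.induction_on with
  | empty => exact ⟨h, by simpa using hN⟩
  | @insert x X _ _ ih =>
    rw [Set.insert_subset_iff] at hXM
    obtain ⟨h', hX⟩ := ih hXM.2
    have := normal_closure_sup hNM hMN hXM.2
    rw [Set.insert_eq, Subgroup.closure_union, sup_assoc, ← Subgroup.zpowers_eq_closure]
    exact (isCyclicOrFiniteFactor_zpowers_sup x _).exists_hasCyclicOrFiniteSeries hX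

theorem commutator_closure_le_iff {X Y : Set G} {M : Subgroup G} [M.Normal] :
    ⁅Subgroup.closure X, Subgroup.closure Y⁆ ≤ M ↔ ∀ x ∈ X, ∀ y ∈ Y, ⁅x, y⁆ ∈ M := by
  rw [← QuotientGroup.ker_mk' M, ← Subgroup.map_eq_bot_iff, Subgroup.map_commutator,
    Subgroup.commutator_eq_bot_iff_le_centralizer, MonoidHom.map_closure, MonoidHom.map_closure,
    Subgroup.closure_le, Subgroup.centralizer_closure]
  simp only [Set.subset_def, Set.forall_mem_image, SetLike.mem_coe, MonoidHom.mem_ker,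
    Subgroup.mem_centralizer_iff_commutator_eq_one', map_commutatorElement]

theorem lowerCentralSeries_succ_eq_closure_sup {S X : Set G} (hS : Subgroup.closure S = ⊤) {i : ℕ}
    (hX : (⊤ : Subgroup G).lowerCentralSeries i =
      Subgroup.closure X ⊔ (⊤ : Subgroup G).lowerCentralSeries (i + 1)) :
    (⊤ : Subgroup G).lowerCentralSeries (i + 1) =
      Subgroup.closure (Set.image2 (⁅·, ·⁆) X S) ⊔
        (⊤ : Subgroup G).lowerCentralSeries (i + 2) := by
  set γ := (⊤ : Subgroup G).lowerCentralSeries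
  have hsucc (j : ℕ) : γ (j + 1) = ⁅γ j, ⊤⁆ := Subgroup.lowerCentralSeries_succ ⊤ j
  have hYle : Set.image2 (⁅·, ·⁆) X S ⊆ γ (i + 1) := by
    rintro _ ⟨x, hx, s, -, rfl⟩
    have hxi : x ∈ γ i := hX ▸ Subgroup.mem_sup_left (Subgroup.subset_closure hx)
    exact Subgroup.commutator_mem_commutator hxi (Subgroup.mem_top s)
  have hanti : γ (i + 2) ≤ γ (i + 1) := Subgroup.lowerCentralSeries_antitone _ (Nat.le_succ _)
  refine le_antisymm ?_ (sup_le ((Subgroup.closure_le _).2 hYle) hanti)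
  have := normal_closure_sup hanti (hsucc (i + 1)).ge hYle
  have hunion : γ i = Subgroup.closure (X ∪ γ (i + 1)) := by
    rw [Subgroup.closure_union, Subgroup.closure_eq, ← hX]
  rw [hsucc, hunion, ← hS, commutator_closure_le_iff]
  rintro x (hx | hx) s hs
  · exact Subgroup.mem_sup_left (Subgroup.subset_closure ⟨x, hx, s, hs, rfl⟩)
  · exact Subgroup.mem_sup_right (Subgroup.commutator_mem_commutator hx (Subgroup.mem_top s))

theorem exists_finite_lowerCentralSeries_eq_closure_sup {S : Set G} (hS : S.Finite)
    (hgen : Subgroup.closure S = ⊤) (i : ℕ) :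
    ∃ X : Set G, X.Finite ∧ (⊤ : Subgroup G).lowerCentralSeries i =
      Subgroup.closure X ⊔ (⊤ : Subgroup G).lowerCentralSeries (i + 1) := by
  induction i with
  | zero => exact ⟨S, hS, by simp [hgen]⟩
  | succ i ih =>
    obtain ⟨X, hX, hXi⟩ := ih
    exact ⟨_, hX.image2 _ hS, lowerCentralSeries_succ_eq_closure_sup hgen hXi⟩

theorem exists_hasCyclicOrFiniteSeries_top [Group.IsNilpotent G] {S : Set G} (hS : S.Finite)
    (hgen : Subgroup.closure S = ⊤) : ∃ h, HasCyclicOrFiniteSeries (⊤ : Subgroup G) h := by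
  refine Nat.decreasingInduction (n := Group.nilpotencyClass G)
    (motive := fun i _ => ∃ h, HasCyclicOrFiniteSeries ((⊤ : Subgroup G).lowerCentralSeries i) h)
    (fun i _ ih => ?_) ⟨0, ?_⟩ (Nat.zero_le _)
  · obtain ⟨h, hi⟩ := ih
    obtain ⟨X, hX, hXi⟩ := exists_finite_lowerCentralSeries_eq_closure_sup hS hgen i
    have hXle : X ⊆ (⊤ : Subgroup G).lowerCentralSeries i :=
      hXi ▸ Subgroup.subset_closure.trans (SetLike.coe_subset_coe.2 le_sup_left)
    rw [hXi]
    exact hi.closure_sup (Subgroup.lowerCentralSeries_antitone _ i.le_succ)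
      (Subgroup.lowerCentralSeries_succ ⊤ i).ge hX hXle
  · rw [Subgroup.lowerCentralSeries_nilpotencyClass]
    exact .bot

theorem hasCyclicOrFiniteSeries_hirschNumber_of_isNilpotent [Group.IsNilpotent G] {S : Set G}
    (hS : S.Finite) (hgen : Subgroup.closure S = ⊤) :
    HasCyclicOrFiniteSeries (⊤ : Subgroup G) (hirschNumber G) := by
  obtain ⟨h, hG⟩ := exists_hasCyclicOrFiniteSeries_top hS hgen
  have := hG.nonempty_cyclicOrFiniteSeries
  exact hasCyclicOrFiniteSeries_hirschNumber

end ExistenceOfSeries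

section WordLength

variable {G : Type*} [Group G]

theorem wordLength_le_iff {S : Set G} {g : G} {n : ℕ} :
    wordLength S g ≤ n ↔
      ∃ l : List G, (∀ x ∈ l, x ∈ S ∨ x⁻¹ ∈ S) ∧ l.prod = g ∧ l.length ≤ n := by
  refine ⟨fun h => ?_, fun ⟨l, hl, hprod, hn⟩ => (iInf₂_le l ⟨hl, hprod⟩).trans (by simpa)⟩
  by_contra! hlong
  have hlt : ((n + 1 : ℕ) : ℕ∞) ≤ n :=
    (le_iInf₂ fun l hl => Nat.cast_le.2 (hlong l hl.1 hl.2)).trans h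
  exact n.lt_irrefl (Nat.cast_le.1 hlt)

/- Reidemeister–Schreier rewriting: for a left transversal `R` of `L` that contains `1`, the
`L`-component of `x * t` is that of `x * r` times that of `t`, where `r ∈ R` represents `t`. -/
theorem exists_finite_wordLength_le (L : Subgroup G) [L.FiniteIndex] {S : Set G}
    (hS : S.Finite) : ∃ U : Set L, U.Finite ∧ ∀ g : L, wordLength U g ≤ wordLength S (g : G) := by
  obtain ⟨R, hR, hR1⟩ := L.exists_isComplement_left 1
  set U : Set L := Set.image2 (fun x r => (hR.equiv (x * r)).2) (S ∪ S⁻¹) R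
  have rewriting : ∀ l : List G, (∀ x ∈ l, x ∈ S ∨ x⁻¹ ∈ S) → ∃ l' : List L,
      (∀ u ∈ l', u ∈ U) ∧ l'.prod = (hR.equiv l.prod).2 ∧ l'.length = l.length := by
    intro l hl
    induction l with
    | nil => exact ⟨[], by simp, by simp [hR.equiv_one hR1 L.one_mem]; rfl, rfl⟩
    | cons x t ih =>
      obtain ⟨t', ht', hprod, hlen⟩ := ih fun y hy => hl y (by simp [hy])
      refine ⟨(hR.equiv (x * (hR.equiv t.prod).1)).2 :: t', ?_, ?_, by simp [hlen]⟩
      · exact List.forall_mem_cons.2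
          ⟨⟨x, hl x (by simp), _, (hR.equiv t.prod).1.2, rfl⟩, ht'⟩
      · have snd_mul := congrArg Prod.snd
          (hR.equiv_mul_right (x * (hR.equiv t.prod).1) (hR.equiv t.prod).2)
        rw [mul_assoc, hR.equiv_fst_mul_equiv_snd] at snd_mul
        rw [List.prod_cons, List.prod_cons, hprod, snd_mul]
  refine ⟨U, (hS.union hS.inv).image2 _ hR.finite_left, fun g => le_iInf₂ fun l hl => ?_⟩
  obtain ⟨l', hl', hprod, hlen⟩ := rewriting l hl.1
  refine wordLength_le_iff.2 ⟨l', fun u hu => .inl (hl' u hu), ?_, hlen.le⟩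
  rw [hprod, hl.2, hR.equiv_snd_eq_self_of_mem_of_one_mem hR1 g.2]
  rfl

theorem HasDegreeLT.exists_norm_le_of_wordLength_le {A : Type*} [SeminormedAddCommGroup A] {d : ℕ}
    {f : G → A} (hf : HasDegreeLT d f) {S : Set G} (hS : S.Finite) :
    ∃ C : ℝ, ∀ (n : ℕ) (g : G), wordLength S g ≤ n → ‖f g‖ ≤ C * (n + 1) ^ d := by
  obtain ⟨C, hC, hbound⟩ := hf.exists_norm_prod_le (hS.union hS.inv)
  refine ⟨C, fun n g hg => ?_⟩
  obtain ⟨l, hl, rfl, hn⟩ := wordLength_le_iff.1 hg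
  exact (hbound l hl).trans (by gcongr)

end WordLength

section Primes

open Filter Asymptotics

theorem eventually_half_le_theta : ∀ᶠ n : ℕ in atTop, (n : ℝ) / 2 ≤ Chebyshev.theta n := by
  have log_small : ∀ᶠ n : ℕ in atTop, Real.log (n + 1) ≤ 1 / 50 * (n + 1) := by
    have hbound := (Real.isLittleO_log_id_atTop.comp_tendsto
      ((tendsto_add_atTop_iff_nat 1).2 tendsto_natCast_atTop_atTop)).bound
      (show (0 : ℝ) < 1 / 50 by norm_num)
    filter_upwards [hbound] with n hn
    have hn' : ‖Real.log (n + 1)‖ ≤ 1 / 50 * |(n + 1 : ℝ)| := by simpa using hn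
    rw [abs_of_pos n.cast_add_one_pos] at hn'
    exact (le_abs_self _).trans hn'
  have sqrt_mul_log_small : ∀ᶠ n : ℕ in atTop, √(n : ℝ) * Real.log n ≤ 1 / 50 * n := by
    have hlog := ((isLittleO_log_rpow_atTop (show (0 : ℝ) < 1 / 2 by norm_num)).comp_tendsto
      tendsto_natCast_atTop_atTop).bound (show (0 : ℝ) < 1 / 50 by norm_num)
    filter_upwards [hlog] with n hn
    simp only [Function.comp_apply, ← Real.sqrt_eq_rpow, Real.norm_eq_abs,
      abs_of_nonneg (Real.sqrt_nonneg (n : ℝ))] at hn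
    calc √(n : ℝ) * Real.log n ≤ √n * (1 / 50 * √n) := by gcongr; exact (le_abs_self _).trans hn
      _ = 1 / 50 * n := by rw [mul_left_comm, Real.mul_self_sqrt n.cast_nonneg]
  filter_upwards [log_small, sqrt_mul_log_small, eventually_ge_atTop 1] with n hlog hsqrt hn
  have hn' : (1 : ℝ) ≤ n := by exact_mod_cast hn
  linarith [Chebyshev.theta_ge n, mul_le_mul_of_nonneg_left Real.log_two_gt_d9.le n.cast_nonneg]

theorem primorial_dvd_of_forall_prime_dvd {M x : ℕ}
    (h : ∀ p : ℕ, p.Prime → p ≤ M → p ∣ x) : primorial M ∣ x := by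
  rw [primorial_eq_prod_primesLE]
  exact Finset.prod_primes_dvd x (fun p hp => (Nat.mem_primesLE.1 hp).2.prime)
    fun p hp => h p (Nat.mem_primesLE.1 hp).2 (Nat.mem_primesLE.1 hp).1

theorem exists_prime_not_dvd_le_log : ∃ K : ℝ, 0 ≤ K ∧ ∀ x : ℕ, x ≠ 0 →
    ∃ p : ℕ, p.Prime ∧ ¬ p ∣ x ∧ (p : ℝ) ≤ K * (1 + Real.log x) := by
  obtain ⟨N, hN⟩ := eventually_atTop.1 eventually_half_le_theta
  refine ⟨N + 2, by positivity, fun x hx => ?_⟩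
  have hlog : 0 ≤ Real.log x := Real.log_natCast_nonneg x
  set M : ℕ := ⌊2 * Real.log x⌋₊ + 1 + N with hM
  have hM_lower : 2 * Real.log x < M := by
    push_cast [hM]
    linarith [Nat.lt_floor_add_one (2 * Real.log x), (N.cast_nonneg : (0 : ℝ) ≤ N)]
  have hM_upper : (M : ℝ) ≤ (N + 2) * (1 + Real.log x) := by
    push_cast [hM]
    nlinarith [Nat.floor_le (show 0 ≤ 2 * Real.log x by positivity),
      mul_nonneg (N.cast_nonneg : (0 : ℝ) ≤ N) hlog]
  suffices ∃ p : ℕ, p.Prime ∧ p ≤ M ∧ ¬ p ∣ x by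
    obtain ⟨p, hp, hpM, hpx⟩ := this
    exact ⟨p, hp, hpx, (Nat.cast_le.2 hpM).trans hM_upper⟩
  by_contra! hdvd
  have theta_le : Chebyshev.theta M ≤ Real.log x := by
    rw [Chebyshev.theta_eq_log_primorial, Nat.floor_natCast]
    exact Real.log_le_log (by exact_mod_cast primorial_pos M) (by
      exact_mod_cast Nat.le_of_dvd (Nat.pos_of_ne_zero hx) (primorial_dvd_of_forall_prime_dvd hdvd))
  linarith [hN M (by lia)]

end Primes

section Growth

variable {G : Type*} [Group G]

theorem log_le_mul_one_add_log {C x : ℝ} {d n : ℕ} (hn : n ≠ 0) (hx : 0 < x)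
    (h : x ≤ C * (n + 1) ^ d) : Real.log x ≤ (|Real.log C| + d) * (1 + Real.log n) := by
  have hn' : (1 : ℝ) ≤ n := by exact_mod_cast Nat.one_le_iff_ne_zero.2 hn
  have hC : 0 < C := pos_of_mul_pos_left (hx.trans_le h) (by positivity)
  have log_succ_le : Real.log (n + 1) ≤ 1 + Real.log n :=
    calc Real.log (n + 1) ≤ Real.log (2 * n) := Real.log_le_log (by positivity) (by linarith)
      _ = Real.log 2 + Real.log n := Real.log_mul two_ne_zero (by positivity)
      _ ≤ 1 + Real.log n := by linarith [Real.log_two_lt_d9]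
  calc Real.log x ≤ Real.log C + d * Real.log (n + 1) := by
        rw [← Real.log_pow, ← Real.log_mul hC.ne' (by positivity)]
        exact Real.log_le_log hx h
    _ ≤ |Real.log C| * (1 + Real.log n) + d * (1 + Real.log n) := by
        gcongr
        exact (le_abs_self _).trans
          (le_mul_of_one_le_right (abs_nonneg _) (by linarith [Real.log_nonneg hn']))
    _ = (|Real.log C| + d) * (1 + Real.log n) := by ring

theorem HasDegreeLT.exists_prime_notMem_powSubgroup {d : ℕ} {f : G → ℤ} (hf : HasDegreeLT d f)
    {S : Set G} (hS : S.Finite) : ∃ K : ℝ, 0 ≤ K ∧ ∀ n : ℕ, n ≠ 0 → ∀ g : G, wordLength S g ≤ n →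
      f g ≠ f 1 → ∃ p : ℕ, p.Prime ∧ g ∉ powSubgroup (⊤ : Subgroup G) p ∧
        (p : ℝ) ≤ K * (1 + Real.log n) := by
  obtain ⟨C, hsize⟩ := (hf.sub_const (f 1)).exists_norm_le_of_wordLength_le hS
  obtain ⟨K, hK, hprime⟩ := exists_prime_not_dvd_le_log
  refine ⟨K * (1 + (|Real.log C| + (d + 1 : ℕ)) + Real.log d.factorial), ?_,
    fun n hn g hg hfg => ?_⟩
  · have := Real.log_natCast_nonneg d.factorial
    positivity
  have hx : (f g - f 1).natAbs ≠ 0 := Int.natAbs_ne_zero.2 (sub_ne_zero.2 hfg)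
  obtain ⟨p, hp, hpx, hpK⟩ := hprime _ (mul_ne_zero hx d.factorial_ne_zero)
  have hdp : d < p := not_le.1 fun hpd => hpx ((hp.dvd_factorial.2 hpd).mul_left _)
  refine ⟨p, hp, fun hmem => hpx (Dvd.dvd.mul_right ?_ _), hpK.trans ?_⟩
  · exact Int.natCast_dvd.1 (by simpa using hf.natCast_dvd_sub_of_mem_powSubgroup hp hdp.le hmem)
  have hlog : Real.log (f g - f 1).natAbs ≤
      (|Real.log C| + (d + 1 : ℕ)) * (1 + Real.log n) :=
    log_le_mul_one_add_log hn (by positivity) (by simpa [Int.norm_eq_abs] using hsize n g hg)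
  rw [mul_assoc, Nat.cast_mul, Real.log_mul (by positivity) (by positivity)]
  gcongr
  nlinarith [mul_nonneg (Real.log_natCast_nonneg d.factorial) (Real.log_natCast_nonneg n),
    Real.log_natCast_nonneg n]

theorem HasSeparatingPolynomial.exists_notMem_powSubgroup {L : Subgroup G} [L.FiniteIndex]
    (hL : HasSeparatingPolynomial L) {S : Set G} (hS : S.Finite) :
    ∃ K : ℝ, 0 ≤ K ∧ ∀ n : ℕ, n ≠ 0 → ∀ g : G, g ≠ 1 → wordLength S g ≤ n →
      ∃ q : ℕ, q ≠ 0 ∧ g ∉ powSubgroup (⊤ : Subgroup G) q ∧ (q : ℝ) ≤ K * (1 + Real.log n) := by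
  obtain ⟨d, f, hf, hsep⟩ := hL
  obtain ⟨U, hU, hUS⟩ := exists_finite_wordLength_le L hS
  obtain ⟨K, hK, hprime⟩ := hf.exists_prime_notMem_powSubgroup hU
  obtain ⟨m, hm, hmL⟩ : ∃ m ≠ 0, ∀ x ∈ (⊤ : Subgroup G), x ^ m ∈ L :=
    exists_pow_mem_of_relIndex_ne_zero (by simpa using Subgroup.FiniteIndex.index_ne_zero)
  refine ⟨m * (1 + K), by positivity, fun n hn g hg hgn => ?_⟩
  have hlog : 0 ≤ Real.log n := Real.log_natCast_nonneg n
  by_cases hgL : g ∈ L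
  · obtain ⟨p, hp, hgp, hpK⟩ := hprime n hn ⟨g, hgL⟩ ((hUS ⟨g, hgL⟩).trans hgn)
      fun h => hg (congrArg Subtype.val (hsep _ h))
    have hle : powSubgroup (⊤ : Subgroup G) (m * p) ≤
        (powSubgroup (⊤ : Subgroup L) p).map L.subtype :=
      powSubgroup_le_iff.2 fun x hx => ⟨⟨x ^ m, hmL x hx⟩ ^ p,
        pow_mem_powSubgroup (Subgroup.mem_top _) p, by simp [pow_mul]⟩
    refine ⟨m * p, mul_ne_zero hm hp.ne_zero, fun hmem => hgp ?_, ?_⟩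
    · obtain ⟨y, hy, rfl⟩ := hle hmem
      exact hy
    · push_cast
      rw [mul_assoc]
      gcongr
      linarith
  · refine ⟨m, hm, fun hmem => hgL (powSubgroup_le_iff.2 hmL hmem), ?_⟩
    rw [mul_assoc]
    exact le_mul_of_one_le_right m.cast_nonneg (by nlinarith)

theorem minQuotient_le_index {g : G} {V : Subgroup G} [V.Normal] [V.FiniteIndex] (hg : g ∉ V) :
    minQuotient g ≤ V.index :=
  iInf₂_le V ⟨inferInstance, inferInstance, hg⟩

theorem HasCyclicOrFiniteSeries.exists_growth_le [Group.IsNilpotent G] {h : ℕ}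
    (hG : HasCyclicOrFiniteSeries (⊤ : Subgroup G) h) {S : Set G} (hS : S.Finite) :
    ∃ K : ℝ, ∀ n : ℕ, n ≠ 0 →
      (growth S n : ℝ≥0∞) ≤ ENNReal.ofReal (K * (1 + Real.log n) ^ h) := by
  obtain ⟨L, -, hindex, hL⟩ := hG.exists_hasSeparatingPolynomial
  have : L.FiniteIndex := ⟨by simpa using hindex⟩
  obtain ⟨K, hK, hshort⟩ := hL.exists_notMem_powSubgroup hS
  obtain ⟨C, hC, hdvd⟩ := hG.exists_relIndex_dvd
  refine ⟨C * K ^ h, fun n hn => ?_⟩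
  have : 0 ≤ Real.log n := Real.log_natCast_nonneg n
  suffices growth_le_floor : growth S n ≤ (⌊C * K ^ h * (1 + Real.log n) ^ h⌋₊ : ℕ∞) by
    calc (growth S n : ℝ≥0∞) ≤ ((⌊C * K ^ h * (1 + Real.log n) ^ h⌋₊ : ℕ∞) : ℝ≥0∞) :=
          ENat.toENNReal_le.2 growth_le_floor
      _ ≤ ENNReal.ofReal (C * K ^ h * (1 + Real.log n) ^ h) := by
          rw [ENat.toENNReal_coe, ← ENNReal.ofReal_natCast]
          exact ENNReal.ofReal_le_ofReal (Nat.floor_le (by positivity))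
  refine iSup₂_le fun g ⟨hg, hgn⟩ => ?_
  obtain ⟨q, hq, hgq, hqK⟩ := hshort n hn g hg hgn
  set V := powSubgroup (⊤ : Subgroup G) q
  have hV : V.index ∣ C * q ^ h := by
    simpa using hdvd q V (by simp [Subgroup.normalizer_eq_top]) fun x hx => pow_mem_powSubgroup hx q
  have hpos : C * q ^ h ≠ 0 := mul_ne_zero hC (pow_ne_zero h hq)
  have : V.FiniteIndex := ⟨ne_zero_of_dvd_ne_zero hpos hV⟩
  refine (minQuotient_le_index hgq).trans (Nat.cast_le.2 (Nat.le_floor ?_))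
  calc (V.index : ℝ) ≤ C * (q : ℝ) ^ h := by
        exact_mod_cast Nat.le_of_dvd (Nat.pos_of_ne_zero hpos) hV
    _ ≤ C * (K * (1 + Real.log n)) ^ h := by gcongr
    _ = C * K ^ h * (1 + Real.log n) ^ h := by rw [mul_pow, mul_assoc]

theorem one_add_log_le_log_mul {C n : ℕ} (hC : 3 ≤ C) (hn : n ≠ 0) :
    1 + Real.log n ≤ Real.log (C * n : ℕ) := by
  have hC' : (3 : ℝ) ≤ C := by exact_mod_cast hC
  rw [Nat.cast_mul, Real.log_mul (by positivity) (by exact_mod_cast hn)]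
  gcongr
  exact (Real.le_log_iff_exp_le (by positivity)).2 (by linarith [Real.exp_one_lt_three])

theorem asympLE_log_pow {F : ℕ → ℝ≥0∞} {K : ℝ} {h : ℕ}
    (hF : ∀ n : ℕ, n ≠ 0 → F n ≤ ENNReal.ofReal (K * (1 + Real.log n) ^ h)) :
    AsympLE F fun n => ENNReal.ofReal (Real.log n ^ h) := by
  refine ⟨⌈K⌉₊ + 3, by positivity, fun n hn => (hF n hn.ne').trans ?_⟩
  have : 0 ≤ 1 + Real.log n := by linarith [Real.log_natCast_nonneg n]
  rw [← ENNReal.ofReal_natCast, ← ENNReal.ofReal_mul (Nat.cast_nonneg _)]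
  refine ENNReal.ofReal_le_ofReal ?_
  gcongr
  · exact (Nat.le_ceil K).trans (by simp)
  · exact one_add_log_le_log_mul (by simp) hn.ne'

end Growth

end ResidualFiniteness

theorem theorem2 {P : Type*} [Group P] (hP : Group.IsNilpotent P)
    (S : Set P) (hS : S.Finite) (hgen : Subgroup.closure S = ⊤) :
    ResidualFiniteness.AsympLE
      (fun n => ((ResidualFiniteness.growth S n : ℕ∞) : ENNReal))
      (fun n => ENNReal.ofReal (Real.log n ^ ResidualFiniteness.hirschNumber P)) := by
  have series := ResidualFiniteness.hasCyclicOrFiniteSeries_hirschNumber_of_isNilpotent hS hgen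
  obtain ⟨K, growth_le⟩ := series.exists_growth_le hS
  exact ResidualFiniteness.asympLE_log_pow growth_le
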